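/- For integers $p\ge q\ge 1$ let $\mathcal I_{p,q}=\{(i,j): 1\le i\le p,\ 1\le j\le q,\ i\ge j\}$, and let the packing orbitope $\mathrm{O}^{\le}_{p,q}\subseteq\mathbb R^{\mathcal I_{p,q}}$ be the convex hull of all $0/1$-matrices of size $p\times q$ that have at most one $1$-entry in each row and whose columns are in (weakly) decreasing lexicographic order. (Such matrices have no $1$-entry above the main diagonal, so those coordinates are dropped.) Then linear optimization over $\mathrm{O}^{\le}_{p,q}$ can be solved in time $O(pq)$: there are a single program for a random access machine over the reals and a constant $C$, both independent of $p,q,d$, such that for all $p\ge q\ge 1$ and all $d\in\mathbb R^{\mathcal I_{p,q}}$ the program, given $p$, $q$ and $d$ (stored row by row), halts after at most $C\,pq$ steps with an optimal solution $x^\star\in\mathrm{O}^{\le}_{p,q}$ of $$\max\{\langle d,x\rangle : x\in \mathrm{O}^{\le}_{p,q}\}.$$ A step is one addition, subtraction or comparison of two real numbers or of two nonnegative integers (used as counters and addresses, with subtraction cut off at $0$), one loading of a natural number constant, one read or write of a memory cell addressed by an integer register, or one null instruction. -/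

import Mathlib

/-- The index set `I_{p,q}` of pairs `(i, j)` on or below the main diagonal of a `p × q` matrix
(rows and columns are numbered from `0`). -/
abbrev OrbitopeInds (p q : ℕ) : Type :=
  {e : Fin p × Fin q // (e.2 : ℕ) ≤ (e.1 : ℕ)}

/-- The `p × q` matrices with entries in `{0, 1}` that have at most one `1`-entry in every row and
whose columns, read from top to bottom, are in (weakly) decreasing lexicographic order. -/
def packingMatrices (p q : ℕ) : Set (Matrix (Fin p) (Fin q) ℝ) :=
  {M | (∀ i j, M i j = 0 ∨ M i j = 1) ∧
    (∀ i j j', M i j = 1 → M i j' = 1 → j = j') ∧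
    Antitone (fun j : Fin q => toLex (fun i : Fin p => M i j))}

/-- The coordinates of a matrix on or below the main diagonal. -/
def lowerPart {p q : ℕ} (M : Matrix (Fin p) (Fin q) ℝ) : OrbitopeInds p q → ℝ :=
  fun e => M e.1.1 e.1.2

/-- The packing orbitope, as a polytope in the space of vectors indexed by `I_{p,q}`. No matrix in
`packingMatrices p q` has a `1` above the main diagonal, so that dropping the coordinates there
loses nothing. -/
def packingOrbitope (p q : ℕ) : Set (OrbitopeInds p q → ℝ) :=
  convexHull ℝ (lowerPart '' packingMatrices p q)

namespace RealRAM

/-- The memory of a random access machine over the reals: integer registers, real registers,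
and arrays (each with cells numbered `0, 1, 2, …`) of integers and of reals. A program names
registers and arrays by fixed numbers, so it uses only finitely many of them. -/
structure State where
  /-- the integer registers -/
  ireg : ℕ → ℕ
  /-- the real registers -/
  rreg : ℕ → ℝ
  /-- the integer arrays: `iarr A a` is cell `a` of array `A` -/
  iarr : ℕ → ℕ → ℕ
  /-- the real arrays: `rarr A a` is cell `a` of array `A` -/
  rarr : ℕ → ℕ → ℝ

/-- The elementary instructions. The letters `u v w` stand for integer registers, `x y z` for real
registers and `A` for an array. There is no multiplication, no rounding, and no
conversion between reals and integers; the only constants are natural numbers. -/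
inductive Instr where
  /-- do nothing -/
  | nop
  /-- `u := k` -/
  | iconst (u k : ℕ)
  /-- `u := v + w` -/
  | iadd (u v w : ℕ)
  /-- `u := max (v - w) 0` -/
  | isub (u v w : ℕ)
  /-- `u := A[v]` for an integer array `A` -/
  | iload (u A v : ℕ)
  /-- `A[v] := u` for an integer array `A` -/
  | istore (A v u : ℕ)
  /-- `x := k` -/
  | rconst (x k : ℕ)
  /-- `x := y + z` -/
  | radd (x y z : ℕ)
  /-- `x := y - z` -/
  | rsub (x y z : ℕ)
  /-- `x := A[v]` for a real array `A` -/
  | rload (x A v : ℕ)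
  /-- `A[v] := x` for a real array `A` -/
  | rstore (A v x : ℕ)

/-- The effect of an elementary instruction on the memory. -/
noncomputable def Instr.apply : Instr → State → State
  | .nop, s => s
  | .iconst u k, s => { s with ireg := Function.update s.ireg u k }
  | .iadd u v w, s => { s with ireg := Function.update s.ireg u (s.ireg v + s.ireg w) }
  | .isub u v w, s => { s with ireg := Function.update s.ireg u (s.ireg v - s.ireg w) }
  | .iload u A v, s => { s with ireg := Function.update s.ireg u (s.iarr A (s.ireg v)) }
  | .istore A v u, s =>
      { s with
        iarr := Function.update s.iarr A (Function.update (s.iarr A) (s.ireg v) (s.ireg u)) }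
  | .rconst x k, s => { s with rreg := Function.update s.rreg x (k : ℝ) }
  | .radd x y z, s => { s with rreg := Function.update s.rreg x (s.rreg y + s.rreg z) }
  | .rsub x y z, s => { s with rreg := Function.update s.rreg x (s.rreg y - s.rreg z) }
  | .rload x A v, s => { s with rreg := Function.update s.rreg x (s.rarr A (s.ireg v)) }
  | .rstore A v x, s =>
      { s with
        rarr := Function.update s.rarr A (Function.update (s.rarr A) (s.ireg v) (s.rreg x)) }

/-- The tests that a program may branch on: comparison of two integer or two real registers. -/
inductive Test where
  /-- `u < v` for integer registers -/
  | ilt (u v : ℕ)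
  /-- `x < y` for real registers -/
  | rlt (x y : ℕ)

/-- The outcome of a test. -/
def Test.Holds : Test → State → Prop
  | .ilt u v, s => s.ireg u < s.ireg v
  | .rlt x y, s => s.rreg x < s.rreg y

/-- Programs: finite texts built from instructions by sequencing, branching and looping. -/
inductive Prog where
  /-- a single instruction -/
  | instr (a : Instr)
  /-- first `P`, then `Q` -/
  | seq (P Q : Prog)
  /-- if `c` then `P` else `Q` -/
  | branch (c : Test) (P Q : Prog)
  /-- while `c` do `P` -/
  | loop (c : Test) (P : Prog)

/-- `Exec P s n s'`: started with memory `s`, the program `P` halts with memory `s'` after exactly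
`n` steps, where every execution of an instruction and every evaluation of a test is one step. -/
inductive Exec : Prog → State → ℕ → State → Prop
  | instr (a : Instr) (s : State) : Exec (.instr a) s 1 (a.apply s)
  | seq {P Q : Prog} {s s' s'' : State} {m n : ℕ} :
      Exec P s m s' → Exec Q s' n s'' → Exec (.seq P Q) s (m + n) s''
  | branch_true {c : Test} {P Q : Prog} {s s' : State} {n : ℕ} :
      c.Holds s → Exec P s n s' → Exec (.branch c P Q) s (1 + n) s'
  | branch_false {c : Test} {P Q : Prog} {s s' : State} {n : ℕ} :
      ¬ c.Holds s → Exec Q s n s' → Exec (.branch c P Q) s (1 + n) s'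
  | loop_false {c : Test} {P : Prog} {s : State} :
      ¬ c.Holds s → Exec (.loop c P) s 1 s
  | loop_true {c : Test} {P : Prog} {s s' s'' : State} {m n : ℕ} :
      c.Holds s → Exec P s m s' → Exec (.loop c P) s' n s'' →
      Exec (.loop c P) s (1 + m + n) s''

/-- Array `A` read, row by row, as a `p × q` matrix whose entries above the diagonal are
ignored. -/
def State.readVector (s : State) (A p q : ℕ) : OrbitopeInds p q → ℝ :=
  fun e => s.rarr A ((e.1.1 : ℕ) * q + (e.1.2 : ℕ))

/-- The memory `s` holds the input: `p` and `q` in the first two integer registers, and the vector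
`d` in real array `0`. Nothing is assumed about the rest of the memory. -/
def State.HoldsInput (s : State) (p q : ℕ) (d : OrbitopeInds p q → ℝ) : Prop :=
  s.ireg 0 = p ∧ s.ireg 1 = q ∧ s.readVector 0 p q = d

end RealRAM

open Finset

/-! ### Labelings

A `0/1`-matrix with at most one `1` per row is encoded by the labels `h i` of its rows: `0` for a
zero row and `j + 1` for a row with its `1` in column `j`. -/

/-! A 0/1-matrix with at most one 1 per row is a word of row labels. Its columns decrease
lexicographically exactly when the word has restricted growth: no label exceeds the running maximum
by more than one (`IsGrowth.labelMatrix_mem`, `exists_isGrowth_of_mem`). A linear objective is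
maximized over the hull at such a matrix, where it is a sum of one weight per row.

So the only state needed to continue a word below row `i` is its running maximum `c`. Either the
next row opens label `c + 1`, or it takes the best of the labels `0, …, c` and leaves `c` unchanged.
This gives a recursion for `tailValue` from the bottom row up, with `q + 1` states per row. The best
old label is a prefix maximum along the row, updated as `c` grows, so each state costs a constant
number of steps. Storing the choices and following them down from `c = 0` yields an optimal word.
The loop invariants show that the program carries this out within `O(pq)` steps. -/

/-- The largest label of the first `i` rows. -/
def runMax (h : ℕ → ℕ) : ℕ → ℕ
  | 0 => 0
  | i + 1 => max (runMax h i) (h i)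

/-- The labels of the first `p` rows are at most `q`, and each exceeds the largest previous one by
at most one. -/
def IsGrowth (p q : ℕ) (h : ℕ → ℕ) : Prop :=
  ∀ i < p, h i ≤ q ∧ h i ≤ runMax h i + 1

/-- The matrix with the row labels `h`. -/
noncomputable def labelMatrix (p q : ℕ) (h : ℕ → ℕ) : Matrix (Fin p) (Fin q) ℝ :=
  fun i j => if h i = j + 1 then 1 else 0

/-- The weight of a label in a row with entries `w`. -/
def labelWeight (w : ℕ → ℝ) : ℕ → ℝ
  | 0 => 0
  | j + 1 => w j

lemma IsGrowth.runMax_le {p q : ℕ} {h : ℕ → ℕ} (hh : IsGrowth p q h) {i : ℕ} (hi : i ≤ p) :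
    runMax h i ≤ i := by
  induction i with
  | zero => simp [runMax]
  | succ i ih =>
    have := (hh i hi).2
    have := ih (by omega)
    simp only [runMax]
    omega

/-- The running maximum rises by at most one at a time, so it skips no label. -/
lemma IsGrowth.exists_of_lt_runMax {p q : ℕ} {h : ℕ → ℕ} (hh : IsGrowth p q h) {i j : ℕ}
    (hi : i ≤ p) (hj : j < runMax h i) : ∃ i' < i, h i' = j + 1 := by
  induction i with
  | zero => simp [runMax] at hj
  | succ i ih =>
    by_cases hlt : j < runMax h i
    · obtain ⟨i', h1, h2⟩ := ih (by omega) hlt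
      exact ⟨i', by omega, h2⟩
    · have := (hh i hi).2
      simp only [runMax] at hj
      exact ⟨i, by omega, by omega⟩

lemma le_runMax {h : ℕ → ℕ} {i i' : ℕ} (hi : i' < i) : h i' ≤ runMax h i := by
  induction i with
  | zero => omega
  | succ i ih =>
    simp only [runMax]
    rcases Nat.lt_succ_iff_lt_or_eq.1 hi with h1 | rfl
    · exact (ih h1).trans (le_max_left _ _)
    · exact le_max_right _ _

/-- If column `j` were smaller than a later column `j'`, the first row where they differ would have
its 1 in column `j'`. By growth, label `j + 1` occurs in an earlier row, where the columns should
still agree, yet that row has only one 1. -/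
lemma IsGrowth.labelMatrix_mem {p q : ℕ} {h : ℕ → ℕ} (hh : IsGrowth p q h) :
    labelMatrix p q h ∈ packingMatrices p q := by
  have h1 : ∀ i j, labelMatrix p q h i j = 1 ↔ h i = j + 1 := by
    intro i j
    simp [labelMatrix]
  refine ⟨fun i j => ?_, fun i j j' hj hj' => ?_, fun j j' hjj => ?_⟩
  · by_cases hc : h i = j + 1 <;> simp [labelMatrix, hc]
  · rw [h1] at hj hj'
    exact Fin.ext (by omega)
  · by_contra hlt
    obtain ⟨i, hpre, hi⟩ := not_le.1 hlt
    have hone : h i = j' + 1 := by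
      by_contra hne
      have h0 : labelMatrix p q h i j' = 0 := by simp [labelMatrix, hne]
      have h2 : 0 ≤ labelMatrix p q h i j := by
        unfold labelMatrix
        split_ifs <;> norm_num
      have h3 : labelMatrix p q h i j < labelMatrix p q h i j' := hi
      linarith
    have hne : j ≠ j' := by
      rintro rfl
      exact lt_irrefl _ hi
    have hjlt : (j : ℕ) < j' := lt_of_le_of_ne hjj (fun e => hne (Fin.ext e))
    have := (hh i i.2).2
    obtain ⟨i', hi', he⟩ := hh.exists_of_lt_runMax (i := i) (j := j) i.2.le (by omega)
    have hi'p : i' < p := hi'.trans i.2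
    have heq : labelMatrix p q h ⟨i', hi'p⟩ j = labelMatrix p q h ⟨i', hi'p⟩ j' :=
      hpre ⟨i', hi'p⟩ hi'
    have h2 : h i' = j' + 1 := (h1 ⟨i', hi'p⟩ j').1 (heq ▸ (h1 ⟨i', hi'p⟩ j).2 he)
    omega

/-- Every matrix in `packingMatrices p q` comes from a labeling. -/
lemma exists_isGrowth_of_mem {p q : ℕ} {M : Matrix (Fin p) (Fin q) ℝ}
    (hM : M ∈ packingMatrices p q) : ∃ h, IsGrowth p q h ∧ M = labelMatrix p q h := by
  classical
  obtain ⟨h01, huniq, hanti⟩ := hM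
  have key : ∀ i : Fin p, ∃ l : ℕ, l ≤ q ∧ ∀ j : Fin q, M i j = 1 ↔ l = j + 1 := by
    intro i
    by_cases hex : ∃ j, M i j = 1
    · obtain ⟨j, hj⟩ := hex
      refine ⟨j + 1, j.2, fun j' => ⟨fun hj' => ?_, fun e => ?_⟩⟩
      · rw [huniq i j j' hj hj']
      · rwa [← show j = j' from Fin.ext (by omega)]
    · refine ⟨0, Nat.zero_le _, fun j' => ⟨fun hj' => (hex ⟨j', hj'⟩).elim, fun e => ?_⟩⟩
      omega
  choose l hlq hl using key
  let h : ℕ → ℕ := fun i => if hi : i < p then l ⟨i, hi⟩ else 0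
  have hh : ∀ i : Fin p, h i = l i := fun i => by simp [h]
  refine ⟨h, fun i hi => ?_, ?_⟩
  · have e : h i = l ⟨i, hi⟩ := hh ⟨i, hi⟩
    refine ⟨e ▸ hlq _, ?_⟩
    by_contra hlt
    push Not at hlt
    have hq := hlq ⟨i, hi⟩
    -- A jump in row `i` skips column `c`, the first one beyond the running maximum. Columns `c` and
    -- `j` both vanish above row `i`, and there `j` has a 1 and `c` a 0, so the order of the columns
    -- is violated.
    let c : Fin q := ⟨runMax h i, by omega⟩
    let j : Fin q := ⟨h i - 1, by omega⟩
    have hj1 : M ⟨i, hi⟩ j = 1 := (hl _ _).2 (by simp only [j]; omega)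
    have hc0 : M ⟨i, hi⟩ c = 0 := by
      refine (h01 _ _).resolve_right fun hc => ?_
      have := (hl _ _).1 hc
      simp only [c] at this
      omega
    have hzero : ∀ i' : Fin p, i' < ⟨i, hi⟩ → ∀ j' : Fin q, runMax h i ≤ j' → M i' j' = 0 := by
      intro i' hi' j' hj'
      refine (h01 _ _).resolve_right fun hc => ?_
      have h2 := (hl _ _).1 hc
      have h3 : h i' ≤ runMax h i := le_runMax (i := i) hi'
      rw [hh] at h3
      omega
    have hlt' : toLex (fun i => M i c) < toLex (fun i => M i j) := by
      refine ⟨⟨i, hi⟩, fun i' hi' => ?_, ?_⟩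
      · change M i' c = M i' j
        rw [hzero i' hi' c le_rfl, hzero i' hi' j (by simp only [j]; omega)]
      · change M _ c < M _ j
        rw [hc0, hj1]
        exact one_pos
    exact absurd (hanti (show c ≤ j from by simp only [c, j, Fin.mk_le_mk]; omega))
      (not_le.2 hlt')
  · ext i j
    unfold labelMatrix
    rw [hh]
    split_ifs with hc
    · exact (hl i j).2 hc
    · exact (h01 i j).resolve_right fun h1 => hc ((hl i j).1 h1)

/-- Row `i` has label at most `i + 1`, so no 1 lies above the diagonal. Hence `w` may take arbitrary
values there, as the unspecified input cells do. -/
lemma IsGrowth.sum_mul_lowerPart {p q : ℕ} {h : ℕ → ℕ} (hh : IsGrowth p q h) (w : ℕ → ℕ → ℝ) :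
    ∑ e : OrbitopeInds p q, w e.1.1 e.1.2 * lowerPart (labelMatrix p q h) e =
      ∑ i ∈ range p, labelWeight (w i) (h i) := by
  classical
  have hsub : ∑ e : OrbitopeInds p q, w e.1.1 e.1.2 * lowerPart (labelMatrix p q h) e =
      ∑ e : Fin p × Fin q, w e.1 e.2 * labelMatrix p q h e.1 e.2 := by
    refine (Finset.sum_subtype (univ.filter fun e : Fin p × Fin q => (e.2 : ℕ) ≤ (e.1 : ℕ))
      (by simp) (fun e => w e.1 e.2 * labelMatrix p q h e.1 e.2)).symm.trans ?_
    refine sum_filter_of_ne fun e _ he => ?_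
    by_contra hlt
    have h1 := (hh e.1 e.1.2).2
    have h2 := hh.runMax_le e.1.2.le
    have h3 : h e.1 ≠ e.2 + 1 := by omega
    exact he (by simp [labelMatrix, h3])
  rw [hsub, Fintype.sum_prod_type, ← Fin.sum_univ_eq_sum_range (fun i => labelWeight (w i) (h i))]
  refine sum_congr rfl fun i _ => ?_
  have hq := (hh i i.2).1
  cases hl : h i with
  | zero => simp [labelMatrix, labelWeight, hl]
  | succ k =>
    rw [sum_eq_single ⟨k, by omega⟩]
    · simp [labelMatrix, labelWeight, hl]
    · intro j _ hj
      have : k ≠ j := fun e => hj (Fin.ext e.symm)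
      simp [labelMatrix, hl, this]
    · simp

/-! ### The recursion over the rows -/

/-- The largest of `0` and the first `c` entries of `w`. -/
noncomputable def bestVal (w : ℕ → ℝ) : ℕ → ℝ
  | 0 => 0
  | c + 1 => if bestVal w c < w c then w c else bestVal w c

/-- A label that attains `bestVal w c`. -/
noncomputable def bestLabel (w : ℕ → ℝ) : ℕ → ℕ
  | 0 => 0
  | c + 1 => if bestVal w c < w c then c + 1 else bestLabel w c

/-- The largest weight that the `k` rows `i, …, i + k - 1` can contribute if `c` is the largest
label above them. -/
noncomputable def tailValue (q : ℕ) (w : ℕ → ℕ → ℝ) : ℕ → ℕ → ℕ → ℝ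
  | 0, _, _ => 0
  | k + 1, i, c =>
    if c < q ∧ tailValue q w k (i + 1) c + bestVal (w i) c < tailValue q w k (i + 1) (c + 1) + w i c
    then tailValue q w k (i + 1) (c + 1) + w i c
    else tailValue q w k (i + 1) c + bestVal (w i) c

/-- The label of row `i` in a solution that attains `tailValue q w (k + 1) i c`. -/
noncomputable def tailLabel (q : ℕ) (w : ℕ → ℕ → ℝ) (k i c : ℕ) : ℕ :=
  if c < q ∧ tailValue q w k (i + 1) c + bestVal (w i) c < tailValue q w k (i + 1) (c + 1) + w i c
  then c + 1 else bestLabel (w i) c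

lemma labelWeight_bestLabel (w : ℕ → ℝ) (c : ℕ) : labelWeight w (bestLabel w c) = bestVal w c := by
  induction c with
  | zero => rfl
  | succ c ih =>
    simp only [bestLabel, bestVal]
    split_ifs
    · rfl
    · exact ih

lemma bestLabel_le (w : ℕ → ℝ) (c : ℕ) : bestLabel w c ≤ c := by
  induction c with
  | zero => rfl
  | succ c ih =>
    simp only [bestLabel]
    split_ifs <;> omega

lemma labelWeight_le_bestVal (w : ℕ → ℝ) {l c : ℕ} (hl : l ≤ c) :
    labelWeight w l ≤ bestVal w c := by
  induction c with
  | zero =>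
    obtain rfl : l = 0 := by omega
    rfl
  | succ c ih =>
    simp only [bestVal]
    rcases Nat.le_succ_iff.1 hl with h | rfl
    · have := ih h
      split_ifs <;> linarith
    · simp only [labelWeight]
      split_ifs <;> linarith

lemma tailLabel_le_succ (q : ℕ) (w : ℕ → ℕ → ℝ) (k i c : ℕ) : tailLabel q w k i c ≤ c + 1 := by
  have := bestLabel_le (w i) c
  unfold tailLabel
  split_ifs <;> omega

lemma tailLabel_le {q c : ℕ} (w : ℕ → ℕ → ℝ) (k i : ℕ) (hc : c ≤ q) : tailLabel q w k i c ≤ q := by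
  have := bestLabel_le (w i) c
  unfold tailLabel
  split_ifs <;> omega

/-- The Bellman equation for the chosen label; the next lemma is the matching inequality for every
admissible label. -/
lemma tailValue_succ_eq (q : ℕ) (w : ℕ → ℕ → ℝ) (k i c : ℕ) :
    tailValue q w (k + 1) i c = labelWeight (w i) (tailLabel q w k i c) +
      tailValue q w k (i + 1) (max c (tailLabel q w k i c)) := by
  have hb := bestLabel_le (w i) c
  simp only [tailValue, tailLabel]
  split_ifs
  · simp [labelWeight, add_comm]
  · rw [labelWeight_bestLabel, max_eq_left hb, add_comm]

lemma le_tailValue_succ {q : ℕ} (w : ℕ → ℕ → ℝ) (k i : ℕ) {c l : ℕ} (hlq : l ≤ q)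
    (hl : l ≤ c + 1) :
    labelWeight (w i) l + tailValue q w k (i + 1) (max c l) ≤ tailValue q w (k + 1) i c := by
  simp only [tailValue]
  rcases Nat.le_succ_iff.1 hl with h | rfl
  · have := labelWeight_le_bestVal (w i) h
    rw [max_eq_left h]
    split_ifs <;> linarith
  · rw [max_eq_right (Nat.le_succ c)]
    have hc : c < q := hlq
    simp only [labelWeight, hc, true_and]
    split_ifs <;> linarith

/-! ### The optimal labeling and its optimality -/

/-- The largest label above row `i` in the optimal solution. -/
noncomputable def optMax (p q : ℕ) (w : ℕ → ℕ → ℝ) : ℕ → ℕ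
  | 0 => 0
  | i + 1 => max (optMax p q w i) (tailLabel q w (p - (i + 1)) i (optMax p q w i))

/-- The labels of the optimal solution. -/
noncomputable def optLabel (p q : ℕ) (w : ℕ → ℕ → ℝ) (i : ℕ) : ℕ :=
  tailLabel q w (p - (i + 1)) i (optMax p q w i)

lemma optMax_le (p q : ℕ) (w : ℕ → ℕ → ℝ) (i : ℕ) : optMax p q w i ≤ q := by
  induction i with
  | zero => exact Nat.zero_le _
  | succ i ih => exact max_le ih (tailLabel_le w _ _ ih)

lemma runMax_optLabel (p q : ℕ) (w : ℕ → ℕ → ℝ) (i : ℕ) :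
    runMax (optLabel p q w) i = optMax p q w i := by
  induction i with
  | zero => rfl
  | succ i ih => rw [runMax, ih, optMax, optLabel]

lemma isGrowth_optLabel (p q : ℕ) (w : ℕ → ℕ → ℝ) : IsGrowth p q (optLabel p q w) := fun i _ => by
  rw [runMax_optLabel]
  exact ⟨tailLabel_le w _ _ (optMax_le p q w i), tailLabel_le_succ _ _ _ _ _⟩

/-- Backward induction from the last row, with the Bellman inequality at each row. -/
lemma IsGrowth.sum_Ico_le_tailValue {p q : ℕ} {h : ℕ → ℕ} (hh : IsGrowth p q h) (w : ℕ → ℕ → ℝ)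
    (k i : ℕ) (hk : i + k = p) :
    ∑ i' ∈ Ico i p, labelWeight (w i') (h i') ≤ tailValue q w k i (runMax h i) := by
  induction k generalizing i with
  | zero => simp [← hk, tailValue]
  | succ k ih =>
    have hi : i < p := by omega
    rw [sum_eq_sum_Ico_succ_bot hi]
    have h1 := ih (i + 1) (by omega)
    have h2 := le_tailValue_succ w k i (hh i hi).1 (hh i hi).2
    rw [runMax] at h1
    linarith

lemma sum_Ico_optLabel (p q : ℕ) (w : ℕ → ℕ → ℝ) (k i : ℕ) (hk : i + k = p) :
    ∑ i' ∈ Ico i p, labelWeight (w i') (optLabel p q w i') =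
      tailValue q w k i (optMax p q w i) := by
  induction k generalizing i with
  | zero => simp [← hk, tailValue]
  | succ k ih =>
    have hi : i < p := by omega
    rw [sum_eq_sum_Ico_succ_bot hi, ih (i + 1) (by omega), tailValue_succ_eq, optMax, optLabel,
      show p - (i + 1) = k by omega]

lemma IsGrowth.sum_le_sum_optLabel {p q : ℕ} {h : ℕ → ℕ} (hh : IsGrowth p q h)
    (w : ℕ → ℕ → ℝ) :
    ∑ i ∈ range p, labelWeight (w i) (h i) ≤
      ∑ i ∈ range p, labelWeight (w i) (optLabel p q w i) := by
  rw [range_eq_Ico, sum_Ico_optLabel p q w p 0 (zero_add p)]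
  exact hh.sum_Ico_le_tailValue w p 0 (zero_add p)

lemma lowerPart_optLabel_mem (p q : ℕ) (w : ℕ → ℕ → ℝ) :
    lowerPart (labelMatrix p q (optLabel p q w)) ∈ packingOrbitope p q :=
  subset_convexHull ℝ _ ⟨_, (isGrowth_optLabel p q w).labelMatrix_mem, rfl⟩

/-- The solution found by the recursion is optimal over the packing orbitope. -/
lemma sum_mul_le_sum_mul_optLabel {p q : ℕ} (w : ℕ → ℕ → ℝ) {z : OrbitopeInds p q → ℝ}
    (hz : z ∈ packingOrbitope p q) :
    ∑ e, w e.1.1 e.1.2 * z e ≤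
      ∑ e, w e.1.1 e.1.2 * lowerPart (labelMatrix p q (optLabel p q w)) e := by
  -- The bound cuts out a half-space, so it suffices to check it on the generating matrices.
  have hconv : Convex ℝ {z : OrbitopeInds p q → ℝ | ∑ e, w e.1.1 e.1.2 * z e ≤
      ∑ e, w e.1.1 e.1.2 * lowerPart (labelMatrix p q (optLabel p q w)) e} := by
    refine convex_halfSpace_le ⟨fun x y => ?_, fun c x => ?_⟩ _
    · simp [mul_add, sum_add_distrib]
    · simp [mul_sum, mul_left_comm]
  refine convexHull_min ?_ hconv hz
  rintro _ ⟨M, hM, rfl⟩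
  obtain ⟨h, hh, rfl⟩ := exists_isGrowth_of_mem hM
  rw [Set.mem_ofPred_eq, hh.sum_mul_lowerPart, (isGrowth_optLabel p q w).sum_mul_lowerPart]
  exact hh.sum_le_sum_optLabel w

namespace RealRAM

/-! ### Bounded-time correctness of programs -/

/-- Started in `s`, the program `P` halts after at most `t` steps in a state satisfying `Q`. -/
def Runs (P : Prog) (s : State) (t : ℕ) (Q : State → Prop) : Prop :=
  ∃ (n : ℕ) (s' : State), Exec P s n s' ∧ n ≤ t ∧ Q s'

namespace Runs

variable {P R S : Prog} {a : Instr} {c : Test} {s : State} {t t' : ℕ} {Q Q' : State → Prop}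

lemma mono (h : Runs P s t Q) (ht : t ≤ t') (hQ : ∀ s, Q s → Q' s) : Runs P s t' Q' := by
  obtain ⟨n, s', h1, h2, h3⟩ := h
  exact ⟨n, s', h1, h2.trans ht, hQ _ h3⟩

/-- The slack `t` lets branch arms of different lengths share one time bound. -/
lemma instr (h : Q (a.apply s)) : Runs (.instr a) s (t + 1) Q :=
  ⟨1, _, .instr a s, by omega, h⟩

lemma seq (h : Runs P s t fun s' => Runs R s' t' Q) : Runs (.seq P R) s (t + t') Q := by
  obtain ⟨n, s', h1, h2, n', s'', h3, h4, h5⟩ := h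
  exact ⟨n + n', s'', .seq h1 h3, by omega, h5⟩

lemma seq_instr (h : Runs P (a.apply s) t Q) : Runs (.seq (.instr a) P) s (t + 1) Q :=
  (seq (instr (t := 0) h)).mono (by omega) fun _ => id

lemma seq_seq (h : Runs (.seq P (.seq R S)) s t Q) : Runs (.seq (.seq P R) S) s t Q := by
  obtain ⟨n, s', h1, h2, h3⟩ := h
  cases h1 with
  | seq h4 h5 =>
    cases h5 with
    | seq h6 h7 => exact ⟨_, s', .seq (.seq h4 h6) h7, by omega, h3⟩

/-- The continuation `S` is moved into both arms, so that each path can be executed symbolically to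
its end. -/
lemma seq_branch (h1 : c.Holds s → Runs (.seq P S) s t Q)
    (h2 : ¬ c.Holds s → Runs (.seq R S) s t Q) :
    Runs (.seq (.branch c P R) S) s (t + 1) Q := by
  by_cases hc : c.Holds s
  · obtain ⟨n, s', h3, h4, h5⟩ := h1 hc
    cases h3 with
    | seq h6 h7 => exact ⟨_, s', .seq (.branch_true hc h6) h7, by omega, h5⟩
  · obtain ⟨n, s', h3, h4, h5⟩ := h2 hc
    cases h3 with
    | seq h6 h7 => exact ⟨_, s', .seq (.branch_false hc h6) h7, by omega, h5⟩

/-- A loop that counts down. -/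
lemma loop_down {I : ℕ → State → Prop} (htest : ∀ k s, I k s → (c.Holds s ↔ 0 < k))
    (hbody : ∀ k s, I (k + 1) s → Runs P s t (I k)) (N : ℕ) (h : I N s) :
    Runs (.loop c P) s (N * (t + 1) + 1) (I 0) := by
  induction N generalizing s with
  | zero => exact ⟨1, s, .loop_false (by simp [htest 0 s h]), by omega, h⟩
  | succ N ih =>
    obtain ⟨n, s', h1, h2, h3⟩ := hbody N s h
    obtain ⟨n', s'', h4, h5, h6⟩ := ih h3
    refine ⟨_, s'', .loop_true ((htest _ s h).2 N.succ_pos) h1 h4, ?_, h6⟩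
    rw [Nat.succ_mul]
    omega

/-- A loop that counts up to `N`. -/
lemma loop_up {I : ℕ → State → Prop} (N : ℕ) (htest : ∀ k ≤ N, ∀ s, I k s → (c.Holds s ↔ k < N))
    (hbody : ∀ k < N, ∀ s, I k s → Runs P s t (I (k + 1))) (h : I 0 s) :
    Runs (.loop c P) s (N * (t + 1) + 1) (I N) := by
  refine (loop_down (I := fun k s => k ≤ N ∧ I (N - k) s) (t := t) ?_ ?_ N ?_).mono le_rfl ?_
  · rintro k s ⟨hk, hI⟩
    rw [htest _ (by omega) s hI]
    omega
  · rintro k s ⟨hk, hI⟩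
    refine (hbody _ (by omega) s hI).mono le_rfl fun s' h' => ⟨by omega, ?_⟩
    rwa [show N - k = N - (k + 1) + 1 by omega]
  · simpa using h
  · intro s h'
    simpa using h'.2

end Runs

/-! ### The program

Integer registers: `0` and `1` hold `p` and `q`, `2` and `9` the constants one and zero, `3` the
row `i`, `4` the address `i * q`, `5` the column, `6` the best label so far, `7` and `8` addresses
and labels, `10` the next column, later the largest label so far. Real registers: `0` and `1` hold
the constants zero and one, `2` the best entry so far, `3` to `5` temporary values. Real array `2`
holds the values of the recursion for the current row, integer array `0` the optimal labels, that
of row `i` below a largest label `c` being stored in cell `i * q + i + c`. -/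

/-- A list of instructions, followed by `P`. -/
def block : List Instr → Prog → Prog
  | [], P => P
  | a :: l, P => .seq (.instr a) (block l P)

/-- Set the constants and the counters. -/
def initConsts : Prog :=
  block [.iconst 2 1, .iconst 9 0, .iconst 3 0, .iconst 4 0, .iconst 5 0, .rconst 0 0]
    (.instr (.rconst 1 1))

/-- Compute `p * q` by counting up the rows. -/
def addressLoop : Prog :=
  .loop (.ilt 3 0) (block [.iadd 4 4 1] (.instr (.iadd 3 3 2)))

/-- Clear the values of the recursion. -/
def clearLoop : Prog :=
  .loop (.ilt 5 1) (block [.rstore 2 5 0] (.instr (.iadd 5 5 2)))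

/-- One column of the recursion: compute the value and the label for the current row and column, and
clear the output cell. -/
def columnStep : Prog :=
  -- Column `j` needs only the old values at `j` and `j + 1`, so sweeping to the right allows one
  -- array to be overwritten in place.
  block [.iadd 7 4 5, .rload 3 0 7, .rstore 1 7 0, .iadd 8 7 3, .iadd 10 5 2,
      .rload 4 2 5, .radd 4 4 2, .rload 5 2 10, .radd 5 5 3]
    (.seq (.branch (.rlt 4 5) (block [.rstore 2 5 5] (.instr (.istore 0 8 10)))
        (block [.rstore 2 5 4] (.instr (.istore 0 8 6))))
      -- Entry `j` joins the prefix maximum only after state `j` has been handled. Adding a zero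
      -- register serves as a move.
      (.seq (.branch (.rlt 2 3) (block [.radd 2 3 0] (.instr (.iadd 6 10 9))) (.instr .nop))
        (.instr (.iadd 5 5 2))))

/-- One row of the recursion; the last largest label `q` allows no new column. -/
def rowStep : Prog :=
  block [.isub 3 3 2, .isub 4 4 1, .iconst 5 0, .iconst 6 0, .rconst 2 0]
    (.seq (.loop (.ilt 5 1) columnStep)
      (block [.iadd 7 4 5, .iadd 8 7 3, .rload 4 2 5, .radd 4 4 2, .rstore 2 5 4]
        (.instr (.istore 0 8 6))))

/-- Look up the label of the current row and write it to the output. -/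
def traceStep : Prog :=
  block [.iadd 7 4 3, .iadd 7 7 10, .iload 8 0 7]
    (.seq (.branch (.ilt 9 8) (block [.iadd 7 4 8, .isub 7 7 2] (.instr (.rstore 1 7 1)))
        (.instr .nop))
      (.seq (.branch (.ilt 10 8) (.instr (.iadd 10 8 9)) (.instr .nop))
        (block [.iadd 4 4 1] (.instr (.iadd 3 3 2)))))

/-- The program that optimizes over the packing orbitope. -/
def orbitopeProg : Prog :=
  .seq initConsts (.seq addressLoop (.seq clearLoop (.seq (.instr (.rstore 2 5 0))
    (.seq (.loop (.ilt 9 3) rowStep) (.seq (.instr (.iconst 10 0))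
      (.loop (.ilt 3 0) traceStep))))))

/-! ### Loop invariants and verification of the program -/

/-- The array `D` read row by row with row length `q`. -/
def rowMajor (D : ℕ → ℝ) (q i c : ℕ) : ℝ := D (i * q + c)

/-- The registers and the input array that no loop of the program changes. -/
structure Consts (p q : ℕ) (D : ℕ → ℝ) (s : State) : Prop where
  i0 : s.ireg 0 = p
  i1 : s.ireg 1 = q
  i2 : s.ireg 2 = 1
  i9 : s.ireg 9 = 0
  r0 : s.rreg 0 = 0
  r1 : s.rreg 1 = 1
  input : s.rarr 0 = D

/-- The label table is correct in the rows from `i` on. -/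
def LabelsFrom (p q : ℕ) (D : ℕ → ℝ) (i : ℕ) (s : State) : Prop :=
  ∀ i' c, i ≤ i' → i' < p → c ≤ q →
    s.iarr 0 (i' * q + i' + c) = tailLabel q (rowMajor D q) (p - (i' + 1)) i' c

/-- The output array vanishes in the rows from `i` on. -/
def ZeroFrom (p q i : ℕ) (s : State) : Prop :=
  ∀ i' c, i ≤ i' → i' < p → c < q → s.rarr 1 (i' * q + c) = 0

/-- The recursion is finished for the rows from `i` on. -/
structure RowInv (p q : ℕ) (D : ℕ → ℝ) (i : ℕ) (s : State) : Prop where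
  consts : Consts p q D s
  le : i ≤ p
  i3 : s.ireg 3 = i
  i4 : s.ireg 4 = i * q
  values : ∀ c ≤ q, s.rarr 2 c = tailValue q (rowMajor D q) (p - i) i c
  labels : LabelsFrom p q D i s
  zero : ZeroFrom p q i s

/-- The recursion is finished for the rows below `i`, and in row `i` for the columns before `j`. -/
structure ColumnInv (p q : ℕ) (D : ℕ → ℝ) (i j : ℕ) (s : State) : Prop where
  consts : Consts p q D s
  i3 : s.ireg 3 = i
  i4 : s.ireg 4 = i * q
  i5 : s.ireg 5 = j
  i6 : s.ireg 6 = bestLabel (rowMajor D q i) j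
  r2 : s.rreg 2 = bestVal (rowMajor D q i) j
  new : ∀ c < j, s.rarr 2 c = tailValue q (rowMajor D q) (p - (i + 1) + 1) i c
  old : ∀ c, j ≤ c → c ≤ q → s.rarr 2 c = tailValue q (rowMajor D q) (p - (i + 1)) (i + 1) c
  labels : LabelsFrom p q D (i + 1) s
  rowLabels : ∀ c < j, s.iarr 0 (i * q + i + c) =
    tailLabel q (rowMajor D q) (p - (i + 1)) i c
  zero : ZeroFrom p q (i + 1) s
  rowZero : ∀ c < j, s.rarr 1 (i * q + c) = 0

/-- The optimal solution has been written to the output in the rows before `i`. -/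
structure TraceInv (p q : ℕ) (D : ℕ → ℝ) (i : ℕ) (s : State) : Prop where
  consts : Consts p q D s
  i3 : s.ireg 3 = i
  i4 : s.ireg 4 = i * q
  i10 : s.ireg 10 = optMax p q (rowMajor D q) i
  labels : LabelsFrom p q D 0 s
  out : ∀ i' c, i' < p → c < q → s.rarr 1 (i' * q + c) =
    if i' < i ∧ optLabel p q (rowMajor D q) i' = c + 1 then 1 else 0

/-- Separates the memory blocks of different rows, of length `q` in the output and `q + 1` in the
label table, so that a write in one row leaves the others intact. -/
lemma succ_mul_le {q i i' : ℕ} (h : i < i') : i * q + q ≤ i' * q := by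
  rw [← Nat.succ_mul]
  exact Nat.mul_le_mul_right q h

lemma runs_initConsts {p q : ℕ} {s : State} (h0 : s.ireg 0 = p) (h1 : s.ireg 1 = q) :
    Runs initConsts s 7 fun s' =>
      Consts p q (s.rarr 0) s' ∧ s'.ireg 3 = 0 ∧ s'.ireg 4 = 0 ∧ s'.ireg 5 = 0 := by
  simp only [initConsts, block]
  iterate 6 apply Runs.seq_instr
  apply Runs.instr
  refine ⟨⟨?_, ?_, ?_, ?_, ?_, ?_, ?_⟩, ?_, ?_, ?_⟩ <;> simp [Instr.apply, h0, h1]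

lemma runs_addressLoop {p q : ℕ} {D : ℕ → ℝ} {s : State} (h : Consts p q D s)
    (h3 : s.ireg 3 = 0) (h4 : s.ireg 4 = 0) (h5 : s.ireg 5 = 0) :
    Runs addressLoop s (p * 3 + 1) fun s' =>
      Consts p q D s' ∧ s'.ireg 3 = p ∧ s'.ireg 4 = p * q ∧ s'.ireg 5 = 0 := by
  refine Runs.loop_up (I := fun k s => Consts p q D s ∧ s.ireg 3 = k ∧ s.ireg 4 = k * q ∧
    s.ireg 5 = 0) p ?_ ?_ (by simp [*])
  · rintro k - s ⟨h, h3, -⟩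
    simp [Test.Holds, h3, h.i0]
  · rintro k - s ⟨⟨h0, h1, h2, h9, hr0, hr1, hD⟩, h3, h4, h5⟩
    simp only [block]
    apply Runs.seq_instr
    apply Runs.instr
    refine ⟨⟨?_, ?_, ?_, ?_, ?_, ?_, ?_⟩, ?_, ?_, ?_⟩ <;> simp [Instr.apply, *, Nat.succ_mul]

lemma runs_clearLoop {p q : ℕ} {D : ℕ → ℝ} {s : State} (h : Consts p q D s)
    (h3 : s.ireg 3 = p) (h4 : s.ireg 4 = p * q) (h5 : s.ireg 5 = 0) :
    Runs clearLoop s (q * 3 + 1) fun s' =>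
      Consts p q D s' ∧ s'.ireg 3 = p ∧ s'.ireg 4 = p * q ∧ s'.ireg 5 = q ∧
        ∀ c < q, s'.rarr 2 c = 0 := by
  refine Runs.loop_up (I := fun k s => Consts p q D s ∧ s.ireg 3 = p ∧ s.ireg 4 = p * q ∧
    s.ireg 5 = k ∧ ∀ c < k, s.rarr 2 c = 0) q ?_ ?_ (by simp [*])
  · rintro k - s ⟨h, -, -, h5, -⟩
    simp [Test.Holds, h5, h.i1]
  · rintro k - s ⟨⟨h0, h1, h2, h9, hr0, hr1, hD⟩, h3, h4, h5, hc⟩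
    simp only [block]
    apply Runs.seq_instr
    apply Runs.instr
    refine ⟨⟨?_, ?_, ?_, ?_, ?_, ?_, ?_⟩, ?_, ?_, ?_, ?_⟩ <;>
      simp [Instr.apply, *]
    intro c hck
    obtain hlt | rfl : c < k ∨ c = k := by omega
    · simp [Function.update_apply, hc c hlt]
    · simp

lemma runs_columnStep {p q i j : ℕ} {D : ℕ → ℝ} {s : State} (hj : j < q)
    (h : ColumnInv p q D i j s) : Runs columnStep s 16 (ColumnInv p q D i (j + 1)) := by
  obtain ⟨⟨h0, h1, h2, h9, hr0, hr1, hD⟩, h3, h4, h5, h6, hr2, hnew, hold, hlab, hrow, hz, hrz⟩ := h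
  have e1 := hold j le_rfl hj.le
  have e2 := hold (j + 1) (by omega) hj
  have e3 : D (i * q + j) = rowMajor D q i j := rfl
  simp only [columnStep, block]
  iterate 9 apply Runs.seq_instr
  -- All four paths through the two branches make the same three array updates; the invariant is
  -- derived from these once.
  have main : ∀ s' : State, Consts p q D s' → s'.ireg 3 = i → s'.ireg 4 = i * q →
      s'.ireg 5 = j + 1 → s'.ireg 6 = bestLabel (rowMajor D q i) (j + 1) →
      s'.rreg 2 = bestVal (rowMajor D q i) (j + 1) →
      s'.rarr 2 = Function.update (s.rarr 2) j
        (tailValue q (rowMajor D q) (p - (i + 1) + 1) i j) →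
      s'.iarr 0 = Function.update (s.iarr 0) (i * q + j + i)
        (tailLabel q (rowMajor D q) (p - (i + 1)) i j) →
      s'.rarr 1 = Function.update (s.rarr 1) (i * q + j) 0 →
      ColumnInv p q D i (j + 1) s' := by
    rintro s' hc g3 g4 g5 g6 gr2 gF gK gX
    refine ⟨hc, g3, g4, g5, g6, gr2, ?_, ?_, ?_, ?_, ?_, ?_⟩
    · intro c hcj
      rw [gF]
      rcases Nat.lt_succ_iff_lt_or_eq.1 hcj with hlt | rfl
      · rw [Function.update_of_ne hlt.ne, hnew c hlt]
      · rw [Function.update_self]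
    · intro c hjc hcq
      rw [gF, Function.update_of_ne (by omega), hold c (by omega) hcq]
    · intro i' c hii hip hcq
      have := succ_mul_le (q := q) (i := i) (i' := i') hii
      rw [gK, Function.update_of_ne (by omega), hlab i' c hii hip hcq]
    · intro c hcj
      rw [gK]
      rcases Nat.lt_succ_iff_lt_or_eq.1 hcj with hlt | rfl
      · rw [Function.update_of_ne (by omega), hrow c hlt]
      · rw [add_right_comm, Function.update_self]
    · intro i' c hii hip hcq
      have := succ_mul_le (q := q) (i := i) (i' := i') hii
      rw [gX, Function.update_of_ne (by omega), hz i' c hii hip hcq]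
    · intro c hcj
      rw [gX]
      rcases Nat.lt_succ_iff_lt_or_eq.1 hcj with hlt | rfl
      · rw [Function.update_of_ne (by omega), hrz c hlt]
      · rw [Function.update_self]
  apply Runs.seq_branch <;> intro hb1 <;> apply Runs.seq_seq <;>
    iterate 2 apply Runs.seq_instr
  all_goals
    simp [Test.Holds, Instr.apply, -not_lt, *] at hb1
    apply Runs.seq_branch <;> intro hb2
  any_goals
    apply Runs.seq_seq
    apply Runs.seq_instr
  all_goals
    apply Runs.seq_instr
    apply Runs.instr
    simp [Test.Holds, Instr.apply, -not_lt, *] at hb2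
  all_goals
    refine main _ ⟨?_, ?_, ?_, ?_, ?_, ?_, ?_⟩ ?_ ?_ ?_ ?_ ?_ ?_ ?_ ?_ <;> clear main <;>
      simp [Instr.apply, tailValue, tailLabel, bestVal, bestLabel, -not_lt, *]

lemma runs_rowStep {p q i : ℕ} {D : ℕ → ℝ} {s : State} (h : RowInv p q D (i + 1) s) :
    Runs rowStep s (5 + (q * 17 + 1 + 6)) (RowInv p q D i) := by
  obtain ⟨⟨h0, h1, h2, h9, hr0, hr1, hD⟩, hi, h3, h4, hF, hlab, hz⟩ := h
  rw [add_comm 5]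
  simp only [rowStep, block]
  iterate 5 apply Runs.seq_instr
  change Runs _ _ (q * 17 + 1 + 6) _
  apply Runs.seq
  refine (Runs.loop_up (I := ColumnInv p q D i) q ?_
    (fun j hj s hs => runs_columnStep hj hs) ?_).mono le_rfl ?_
  · rintro k - s hs
    simp [Test.Holds, hs.i5, hs.consts.i1]
  · refine ⟨⟨?_, ?_, ?_, ?_, ?_, ?_, ?_⟩, ?_, ?_, ?_, ?_, ?_, ?_, ?_, ?_, ?_, ?_, ?_⟩
    any_goals simp [Instr.apply, bestLabel, bestVal, Nat.succ_mul, *]; done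
    · simpa [Instr.apply] using hF
    · simpa [Instr.apply, LabelsFrom] using hlab
    · simpa [Instr.apply, ZeroFrom] using hz
  · clear hF hlab hz h0 h1 h2 h3 h4 h9 hr0 hr1 hD
    clear s
    rintro s ⟨⟨h0, h1, h2, h9, hr0, hr1, hD⟩, h3, h4, h5, h6, hr2, hnew, hold, hlab, hrow, hz, hrz⟩
    iterate 5 apply Runs.seq_instr
    apply Runs.instr
    -- The column loop stops before state `q`, whose cell still holds the value from the row below.
    have e1 := hold q le_rfl le_rfl
    refine ⟨⟨?_, ?_, ?_, ?_, ?_, ?_, ?_⟩, by omega, ?_, ?_, ?_, ?_, ?_⟩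
    any_goals simp [Instr.apply, *]; done
    · intro c hc
      rw [show p - i = p - (i + 1) + 1 by omega]
      obtain hlt | rfl : c < q ∨ c = q := by omega
      · simp [Instr.apply, h5, Function.update_of_ne hlt.ne, hnew c hlt]
      · simp [Instr.apply, h5, e1, hr2, tailValue]
    · intro i' c hii hip hc
      obtain rfl | hlt : i = i' ∨ i < i' := by omega
      · obtain hlt | rfl : c < q ∨ c = q := by omega
        · simp [Instr.apply, h3, h4, h5, hrow c hlt,
            show i * q + i + c ≠ i * q + q + i by omega]
        · simp [Instr.apply, h3, h4, h5, h6, add_right_comm, tailLabel]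
      · have := succ_mul_le (q := q) hlt
        simp [Instr.apply, h3, h4, h5, hlab i' c hlt hip hc,
            show i' * q + i' + c ≠ i * q + q + i by omega]
    · intro i' c hii hip hc
      obtain rfl | hlt : i = i' ∨ i < i' := by omega
      · simpa [Instr.apply] using hrz c hc
      · simpa [Instr.apply] using hz i' c hlt hip hc

lemma runs_traceStep {p q i : ℕ} {D : ℕ → ℝ} {s : State} (hi : i < p) (h : TraceInv p q D i s) :
    Runs traceStep s 11 (TraceInv p q D (i + 1)) := by
  obtain ⟨⟨h0, h1, h2, h9, hr0, hr1, hD⟩, h3, h4, h10, hlab, hout⟩ := h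
  have hK := hlab i (optMax p q (rowMajor D q) i) (Nat.zero_le _) hi (optMax_le p q _ i)
  rw [show tailLabel q (rowMajor D q) (p - (i + 1)) i (optMax p q (rowMajor D q) i) =
    optLabel p q (rowMajor D q) i from rfl] at hK
  have hle : optLabel p q (rowMajor D q) i ≤ q := (isGrowth_optLabel p q _ i hi).1
  have hmax : optMax p q (rowMajor D q) (i + 1) =
    max (optMax p q (rowMajor D q) i) (optLabel p q (rowMajor D q) i) := rfl
  have main : ∀ s' : State, Consts p q D s' → s'.ireg 3 = i + 1 → s'.ireg 4 = i * q + q →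
      s'.ireg 10 = max (optMax p q (rowMajor D q) i) (optLabel p q (rowMajor D q) i) →
      s'.iarr 0 = s.iarr 0 →
      s'.rarr 1 = (if 0 < optLabel p q (rowMajor D q) i then
        -- Label `l` stands for column `l - 1`; the guard keeps the subtraction from being cut off.
        Function.update (s.rarr 1) (i * q + optLabel p q (rowMajor D q) i - 1) 1
        else s.rarr 1) →
      TraceInv p q D (i + 1) s' := by
    intro s' hc g3 g4 g10 gK gX
    refine ⟨hc, g3, by rw [g4, Nat.succ_mul], g10.trans hmax.symm, ?_, ?_⟩
    · intro i' c
      rw [gK]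
      exact hlab i' c
    · intro i' c hip hcq
      have hold := hout i' c hip hcq
      rw [gX]
      rcases lt_trichotomy i' i with hlt | rfl | hlt
      · have := succ_mul_le (q := q) hlt
        have hlt' : i' < i + 1 := by omega
        simp only [hlt, true_and] at hold
        simp only [hlt', true_and, ← hold]
        split_ifs
        · rw [Function.update_of_ne (by omega)]
        · rfl
      · simp only [lt_irrefl, false_and, if_false] at hold
        simp only [Nat.lt_succ_self, true_and]
        split_ifs with hpos heq heq
        · rw [show i' * q + optLabel p q (rowMajor D q) i' - 1 = i' * q + c by omega,
            Function.update_self]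
        · rw [Function.update_of_ne (by omega), hold]
        · omega
        · exact hold
      · have := succ_mul_le (q := q) hlt
        have hlt' : ¬ i' < i + 1 := by omega
        simp only [hlt.not_gt, false_and, if_false] at hold
        simp only [hlt', false_and, if_false]
        split_ifs
        · rw [Function.update_of_ne (by omega), hold]
        · exact hold
  simp only [traceStep, block]
  iterate 3 apply Runs.seq_instr
  generalize optLabel p q (rowMajor D q) i = l at *
  generalize optMax p q (rowMajor D q) i = m at *
  apply Runs.seq_branch <;> intro hb1
  · apply Runs.seq_seq
    apply Runs.seq_instr
    apply Runs.seq_seq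
    iterate 2 apply Runs.seq_instr
    simp [Test.Holds, Instr.apply, -not_lt, *] at hb1
    apply Runs.seq_branch <;> intro hb2 <;> apply Runs.seq_instr <;> apply Runs.seq_instr <;>
      apply Runs.instr <;> simp [Test.Holds, Instr.apply, -not_lt, *] at hb2 <;>
      refine main _ ⟨?_, ?_, ?_, ?_, ?_, ?_, ?_⟩ ?_ ?_ ?_ ?_ ?_ <;> clear main <;>
      simp [Instr.apply, -not_lt, *] <;> omega
  · apply Runs.seq_instr
    simp [Test.Holds, Instr.apply, -not_lt, *] at hb1
    apply Runs.seq_branch <;> intro hb2 <;> apply Runs.seq_instr <;> apply Runs.seq_instr <;>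
      apply Runs.instr <;> simp [Test.Holds, Instr.apply, -not_lt, *] at hb2 <;>
      refine main _ ⟨?_, ?_, ?_, ?_, ?_, ?_, ?_⟩ ?_ ?_ ?_ ?_ ?_ <;> clear main <;>
      simp [Instr.apply, -not_lt, *]

lemma runs_orbitopeProg {p q : ℕ} {s : State} (h0 : s.ireg 0 = p) (h1 : s.ireg 1 = q) :
    Runs orbitopeProg s (7 + (p * 3 + 1 + (q * 3 + 1 + (1 + (p * (5 + (q * 17 + 1 + 6) + 1) + 1 +
      (1 + (p * 12 + 1))))))) (TraceInv p q (s.rarr 0) p) := by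
  refine Runs.seq ((runs_initConsts h0 h1).mono le_rfl ?_)
  rintro s₁ ⟨hc, h3, h4, h5⟩
  refine Runs.seq ((runs_addressLoop hc h3 h4 h5).mono le_rfl ?_)
  rintro s₂ ⟨hc, h3, h4, h5⟩
  refine Runs.seq ((runs_clearLoop hc h3 h4 h5).mono le_rfl ?_)
  rintro s₃ ⟨⟨h0, h1, h2, h9, hr0, hr1, hD⟩, h3, h4, h5, hF⟩
  -- There are `q + 1` states; this store clears the cell of state `q`, which the clearing loop
  -- leaves out.
  refine Runs.seq (Runs.instr (t := 0) ?_)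
  refine Runs.seq ((Runs.loop_down (I := RowInv p q (s.rarr 0)) ?_ (fun i s => runs_rowStep) p
    ?_).mono le_rfl ?_)
  · intro i s hs
    simp [Test.Holds, hs.consts.i9, hs.i3]
  · refine ⟨⟨?_, ?_, ?_, ?_, ?_, ?_, ?_⟩, le_rfl, ?_, ?_, ?_, ?_, ?_⟩
    any_goals simp [Instr.apply, *]; done
    · intro c hc
      obtain hlt | rfl : c < q ∨ c = q := by omega
      · simp [Instr.apply, h5, Function.update_of_ne hlt.ne, hF c hlt, tailValue]
      · simp [Instr.apply, h5, hr0, tailValue]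
    · intro i' c h1 h2
      omega
    · intro i' c h1 h2
      omega
  · clear h0 h1 h2 h9 hr0 hr1 hD
    rintro s₄ ⟨⟨h0, h1, h2, h9, hr0, hr1, hD⟩, -, h3, h4, -, hlab, hz⟩
    refine Runs.seq (Runs.instr (t := 0) ?_)
    refine Runs.loop_up p ?_ (fun i hi s => runs_traceStep hi) ?_
    · intro i _ s hs
      simp [Test.Holds, hs.consts.i0, hs.i3]
    · refine ⟨⟨?_, ?_, ?_, ?_, ?_, ?_, ?_⟩, ?_, ?_, ?_, ?_, ?_⟩
      any_goals simp [Instr.apply, optMax, *]; done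
      · simpa [Instr.apply, LabelsFrom] using hlab
      · intro i' c h1 h2
        simpa [Instr.apply] using hz i' c (Nat.zero_le _) h1 h2

end RealRAM

/-- One program solves, in `O(pq)` steps, `max {⟨d, x⟩ : x ∈ packingOrbitope p q}` for all
`p ≥ q ≥ 1` and all real `d`, leaving an optimal solution in real array `1`. -/
theorem corollary3p4 :
    ∃ (P : RealRAM.Prog) (C : ℕ), ∀ (p q : ℕ), 1 ≤ q → q ≤ p →
      ∀ (d : OrbitopeInds p q → ℝ) (s : RealRAM.State), s.HoldsInput p q d →
        ∃ (n : ℕ) (s' : RealRAM.State), RealRAM.Exec P s n s' ∧ n ≤ C * (p * q) ∧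
          s'.readVector 1 p q ∈ packingOrbitope p q ∧
          ∀ z ∈ packingOrbitope p q,
            ∑ e, d e * z e ≤ ∑ e, d e * s'.readVector 1 p q e := by
  refine ⟨RealRAM.orbitopeProg, 64, fun p q hq hqp d s ⟨h0, h1, hd⟩ => ?_⟩
  obtain ⟨n, s', hexec, hn, htrace⟩ := RealRAM.runs_orbitopeProg h0 h1
  have hout : s'.readVector 1 p q =
      lowerPart (labelMatrix p q (optLabel p q (RealRAM.rowMajor (s.rarr 0) q))) := by
    funext e
    have := htrace.out e.1.1 e.1.2 e.1.1.2 e.1.2.2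
    simp only [e.1.1.2, true_and] at this
    exact this
  refine ⟨n, s', hexec, hn.trans ?_, hout ▸ lowerPart_optLabel_mem p q _, fun z hz => ?_⟩
  -- The total is `17pq + 28p + 3q + 13`, at most `61pq` since `1 ≤ q ≤ p`; 64 leaves room.
  · have hp : p ≤ p * q := Nat.le_mul_of_pos_right p hq
    have e : p * (5 + (q * 17 + 1 + 6) + 1) = 17 * (p * q) + 13 * p := by ring
    omega
  · rw [hout, ← hd]
    exact sum_mul_le_sum_mul_optLabel (RealRAM.rowMajor (s.rarr 0) q) hz
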